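/- Let $k$ be an arbitrary field and let $M,N\ge 2$ be integers. Let $$\Gamma_{M,N}=\langle g_0,\dots,g_{M-1}\mid g_0^N=\dots=g_{M-1}^N=1,\ [g_{i_1}\cdots g_{i_N},\,g_{j_1}\cdots g_{j_N}]=1\rangle,$$ where the commutator relations run over all indices $i_1,\dots,i_N,j_1,\dots,j_N\in\{0,\dots,M-1\}$, and let the cyclic group $\mathbb Z_M=\langle h\rangle$ act on $\Gamma_{M,N}$ by automorphisms through $h\cdot g_i=g_{i+1}$ (indices modulo $M$). For a finite group $H$ acting by automorphisms on a group $\Gamma$, let $k[\Gamma]\rtimes k^H$ denote the smash coproduct Hopf algebra: it is $k[\Gamma]\otimes k^H$ as an algebra, where $k[\Gamma]$ is the group algebra and $k^H$ is the algebra of $k$-valued functions on $H$, and, writing $r\#\delta_x=r\otimes\delta_x$, its comultiplication, counit and antipode are given for $r\in\Gamma$, $x\in H$ by $$\Delta(r\#\delta_x)=\sum_{l\in H}(r\#\delta_l)\otimes(l^{-1}\cdot r\,\#\,\delta_{l^{-1}x}),\qquad \varepsilon(r\#\delta_x)=\delta_{x,1},\qquad S(r\#\delta_x)=x^{-1}\cdot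 r^{-1}\,\#\,\delta_{x^{-1}}.$$ Assume that one of the following conditions holds: 1. $N=2$ and $M$ is prime; 2. $M=2$ and $N$ is prime. Let $A$ be a Hopf algebra over $k$ that is infinite-dimensional and not cocommutative, and let $f:k[\Gamma_{M,N}]\rtimes k^{\mathbb Z_M}\to A$ be a surjective Hopf algebra map. Then $f$ is an isomorphism of Hopf algebras. -/

import Mathlib

open scoped TensorProduct commutatorElement

noncomputable section

/-! ### The smash coproduct `k[Γ] ⋊ k^H` -/

/-- The underlying algebra of the smash coproduct `k[Γ] ⋊ k^H`: the tensor product algebra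
`k[Γ] ⊗ k^H`, where `k^H` is the algebra of functions on `H` with pointwise operations.
A type synonym, since its coalgebra structure is not the tensor product one. -/
def SmashCoproduct (k Γ H : Type*) [Field k] [Group Γ] : Type _ :=
  MonoidAlgebra k Γ ⊗[k] (H → k)

namespace SmashCoproduct

section Algebra

variable (k Γ H : Type*) [Field k] [Group Γ]

instance instRing : Ring (SmashCoproduct k Γ H) :=
  inferInstanceAs (Ring (MonoidAlgebra k Γ ⊗[k] (H → k)))

instance instAlgebra : Algebra k (SmashCoproduct k Γ H) :=
  inferInstanceAs (Algebra k (MonoidAlgebra k Γ ⊗[k] (H → k)))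

variable {Γ H} [DecidableEq H]

/-- The element `r # δ_h = r ⊗ δ_h` of `k[Γ] ⋊ k^H`. -/
def elt (r : Γ) (h : H) : SmashCoproduct k Γ H :=
  (MonoidAlgebra.single r (1 : k) ⊗ₜ[k] (Pi.single h (1 : k) : H → k) :
    MonoidAlgebra k Γ ⊗[k] (H → k))

variable (Γ H) [Fintype H]

/-- The basis `(r # δ_h)` of `k[Γ] ⋊ k^H`. -/
def basis : Module.Basis (Γ × H) k (SmashCoproduct k Γ H) :=
  Module.Basis.tensorProduct (Module.Basis.ofRepr (MonoidAlgebra.coeffLinearEquiv k))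
    (Pi.basisFun k H)

variable {Γ H}

@[simp]
theorem basis_apply (p : Γ × H) : basis k Γ H p = elt k p.1 p.2 := by
  unfold basis elt
  erw [Module.Basis.tensorProduct_apply]
  simp
  rfl

theorem elt_mul_elt (r s : Γ) (h l : H) :
    elt k r h * elt k s l = if h = l then elt k (r * s) h else 0 := by
  have key : elt k r h * elt k s l = ((MonoidAlgebra.single (r * s) (1 : k)) ⊗ₜ[k]
      ((Pi.single h (1 : k) : H → k) * Pi.single l 1) : MonoidAlgebra k Γ ⊗[k] (H → k)) := by
    have h1 := Algebra.TensorProduct.tmul_mul_tmul (R := k) (MonoidAlgebra.single r (1 : k))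
      (MonoidAlgebra.single s (1 : k)) (Pi.single h (1 : k) : H → k) (Pi.single l (1 : k))
    rw [MonoidAlgebra.single_mul_single, one_mul] at h1
    exact h1
  rw [key]
  by_cases e : h = l
  · subst e
    rw [if_pos rfl, ← Pi.single_mul, one_mul]
    rfl
  · have : (Pi.single h (1 : k) : H → k) * Pi.single l 1 = 0 := by
      ext x
      by_cases hx : x = h
      · subst hx
        simp [e]
      · simp [hx]
    rw [if_neg e, this, TensorProduct.tmul_zero]
    rfl

theorem one_eq_sum : (1 : SmashCoproduct k Γ H) = ∑ h : H, elt k (1 : Γ) h := by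
  have h1 : (1 : H → k) = ∑ h : H, Pi.single h (1 : k) := by
    rw [Finset.univ_sum_single (fun _ : H => (1 : k))]
    rfl
  change (1 : MonoidAlgebra k Γ) ⊗ₜ[k] (1 : H → k) = _
  rw [h1, TensorProduct.tmul_sum]
  rfl

end Algebra

section Hopf

variable (k Γ H : Type*) [Field k] [Group Γ] [Group H] [Fintype H] [DecidableEq H]

/-- The counit `ε(r # δ_h) = δ_{h,1}`. -/
def counitMap : SmashCoproduct k Γ H →ₗ[k] k :=
  (basis k Γ H).constr k fun p => if p.2 = 1 then 1 else 0

variable {Γ H} in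
@[simp]
theorem counitMap_elt (r : Γ) (h : H) :
    counitMap k Γ H (elt k r h) = if h = 1 then 1 else 0 := by
  rw [← basis_apply k (r, h), counitMap, Module.Basis.constr_basis]

theorem counitMap_mul (x y : SmashCoproduct k Γ H) :
    counitMap k Γ H (x * y) = counitMap k Γ H x * counitMap k Γ H y := by
  have : (LinearMap.mul k (SmashCoproduct k Γ H)).compr₂ (counitMap k Γ H) =
      (LinearMap.mul k k).compl₁₂ (counitMap k Γ H) (counitMap k Γ H) := by
    refine (basis k Γ H).ext fun ⟨r, h⟩ => (basis k Γ H).ext fun ⟨s, l⟩ => ?_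
    simp only [basis_apply, LinearMap.compr₂_apply, LinearMap.mul_apply', elt_mul_elt,
      LinearMap.compl₁₂_apply, counitMap_elt, apply_ite (counitMap k Γ H), map_zero]
    grind
  exact LinearMap.congr_fun₂ this x y

variable [MulDistribMulAction H Γ]

/-- The comultiplication `Δ(r # δ_h) = ∑_l (r # δ_l) ⊗ (l⁻¹ • r # δ_{l⁻¹ h})`. -/
def comulMap : SmashCoproduct k Γ H →ₗ[k] SmashCoproduct k Γ H ⊗[k] SmashCoproduct k Γ H :=
  (basis k Γ H).constr k fun p => ∑ l : H, elt k p.1 l ⊗ₜ[k] elt k (l⁻¹ • p.1) (l⁻¹ * p.2)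

/-- The antipode `S(r # δ_h) = h⁻¹ • r⁻¹ # δ_{h⁻¹}`. -/
def antipodeMap : SmashCoproduct k Γ H →ₗ[k] SmashCoproduct k Γ H :=
  (basis k Γ H).constr k fun p => elt k (p.2⁻¹ • p.1⁻¹) p.2⁻¹

variable {Γ H}

@[simp]
theorem comulMap_elt (r : Γ) (h : H) : comulMap k Γ H (elt k r h) =
    ∑ l : H, elt k r l ⊗ₜ[k] elt k (l⁻¹ • r) (l⁻¹ * h) := by
  rw [← basis_apply k (r, h), comulMap, Module.Basis.constr_basis]

@[simp]
theorem antipodeMap_elt (r : Γ) (h : H) :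
    antipodeMap k Γ H (elt k r h) = elt k (h⁻¹ • r⁻¹) h⁻¹ := by
  rw [← basis_apply k (r, h), antipodeMap, Module.Basis.constr_basis]

variable (Γ H)

instance instCoalgebra : Coalgebra k (SmashCoproduct k Γ H) where
  comul := comulMap k Γ H
  counit := counitMap k Γ H
  coassoc := by
    refine (basis k Γ H).ext fun ⟨r, h⟩ => ?_
    simp only [basis_apply, LinearMap.comp_apply, comulMap_elt, map_sum,
      LinearMap.rTensor_tmul, LinearMap.lTensor_tmul, TensorProduct.sum_tmul,
      TensorProduct.tmul_sum, LinearEquiv.coe_coe, TensorProduct.assoc_tmul]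
    rw [Finset.sum_comm]
    refine Finset.sum_congr rfl fun l _ => ?_
    refine Fintype.sum_equiv (Equiv.mulLeft l⁻¹) _ _ fun m => ?_
    simp [smul_smul, mul_assoc]
  rTensor_counit_comp_comul := by
    refine (basis k Γ H).ext fun ⟨r, h⟩ => ?_
    simp [TensorProduct.ite_tmul]
  lTensor_counit_comp_comul := by
    refine (basis k Γ H).ext fun ⟨r, h⟩ => ?_
    simp [TensorProduct.tmul_ite, inv_mul_eq_one]

theorem comulMap_mul (x y : SmashCoproduct k Γ H) :
    comulMap k Γ H (x * y) = comulMap k Γ H x * comulMap k Γ H y := by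
  have : (LinearMap.mul k (SmashCoproduct k Γ H)).compr₂ (comulMap k Γ H) =
      (LinearMap.mul k (SmashCoproduct k Γ H ⊗[k] SmashCoproduct k Γ H)).compl₁₂
        (comulMap k Γ H) (comulMap k Γ H) := by
    refine (basis k Γ H).ext fun ⟨r, h⟩ => (basis k Γ H).ext fun ⟨s, l⟩ => ?_
    simp only [basis_apply, LinearMap.compr₂_apply, LinearMap.mul_apply',
      LinearMap.compl₁₂_apply, comulMap_elt, Finset.sum_mul_sum,
      Algebra.TensorProduct.tmul_mul_tmul]
    have inner : ∀ a : H,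
        ∑ b : H, (elt k r a * elt k s b) ⊗ₜ[k]
          (elt k (a⁻¹ • r) (a⁻¹ * h) * elt k (b⁻¹ • s) (b⁻¹ * l)) =
        elt k (r * s) a ⊗ₜ[k] (if h = l then elt k (a⁻¹ • (r * s)) (a⁻¹ * h) else 0) := by
      intro a
      rw [Finset.sum_eq_single a]
      · simp only [elt_mul_elt, if_true, mul_right_inj, smul_mul']
      · intro b _ hb
        rw [elt_mul_elt, if_neg (Ne.symm hb), TensorProduct.zero_tmul]
      · simp
    rw [Finset.sum_congr rfl fun a _ => inner a, elt_mul_elt]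
    by_cases e : h = l
    · simp [e]
    · simp [e]
  exact LinearMap.congr_fun₂ this x y

instance instBialgebra : Bialgebra k (SmashCoproduct k Γ H) :=
  Bialgebra.mk' k (SmashCoproduct k Γ H)
    (by
      change counitMap k Γ H 1 = 1
      simp [one_eq_sum])
    (fun {x y} => counitMap_mul k Γ H x y)
    (by
      change comulMap k Γ H 1 = 1
      rw [Algebra.TensorProduct.one_def, one_eq_sum]
      simp only [map_sum, comulMap_elt, smul_one, TensorProduct.sum_tmul, TensorProduct.tmul_sum]
      rw [Finset.sum_comm]
      conv_rhs => rw [Finset.sum_comm]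
      exact Finset.sum_congr rfl fun l _ =>
        Fintype.sum_equiv (Equiv.mulLeft l⁻¹) _ _ fun m => by simp)
    (fun {x y} => comulMap_mul k Γ H x y)

instance instHopfAlgebra : HopfAlgebra k (SmashCoproduct k Γ H) where
  antipode := antipodeMap k Γ H
  mul_antipode_rTensor_comul := by
    refine (basis k Γ H).ext fun ⟨r, h⟩ => ?_
    change LinearMap.mul' k _ ((antipodeMap k Γ H).rTensor _ (comulMap k Γ H (basis k Γ H (r, h))))
      = algebraMap k _ (counitMap k Γ H (basis k Γ H (r, h)))
    simp only [basis_apply, comulMap_elt, map_sum, LinearMap.rTensor_tmul, antipodeMap_elt,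
      LinearMap.mul'_apply, elt_mul_elt, counitMap_elt]
    by_cases e : h = 1
    · subst e
      simp only [mul_one, if_true, map_one, ← smul_mul', inv_mul_cancel, smul_one, one_eq_sum]
      exact Fintype.sum_equiv (Equiv.inv H) _ _ fun m => by simp
    · simp [e]
  mul_antipode_lTensor_comul := by
    refine (basis k Γ H).ext fun ⟨r, h⟩ => ?_
    change LinearMap.mul' k _ ((antipodeMap k Γ H).lTensor _ (comulMap k Γ H (basis k Γ H (r, h))))
      = algebraMap k _ (counitMap k Γ H (basis k Γ H (r, h)))
    simp only [basis_apply, comulMap_elt, map_sum, LinearMap.lTensor_tmul, antipodeMap_elt,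
      LinearMap.mul'_apply, elt_mul_elt, counitMap_elt]
    by_cases e : h = 1
    · subst e
      simp [one_eq_sum]
    · have e' : ∀ x : H, ¬ (x = h⁻¹ * x) := fun x hx => e (by simpa using hx)
      simp [e, e']

end Hopf

end SmashCoproduct

/-! ### The group `Γ_{M,N}` with its cyclic `ℤ/M`-action -/

/-- The relators of `Γ_{M,N}`, in the free group on `g_i`, `i ∈ ℤ/M`: the powers `g_i ^ N` and the
commutators of any two words `g_{i_1} ⋯ g_{i_N}` and `g_{j_1} ⋯ g_{j_N}`. -/
def gammaRels (M N : ℕ) : Set (FreeGroup (ZMod M)) :=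
  {w | ∃ i : ZMod M, w = FreeGroup.of i ^ N} ∪
  {w | ∃ i j : Fin N → ZMod M,
    w = ⁅(List.ofFn fun t => FreeGroup.of (i t)).prod, (List.ofFn fun t => FreeGroup.of (j t)).prod⁆}

/-- The group `Γ_{M,N}`, generated by `g_0, …, g_{M-1}` (indexed by `ℤ/M`) subject to
`g_i ^ N = 1` and `[g_{i_1} ⋯ g_{i_N}, g_{j_1} ⋯ g_{j_N}] = 1`. -/
def GammaGroup (M N : ℕ) : Type :=
  PresentedGroup (gammaRels M N)

namespace GammaGroup

variable (M N : ℕ)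

instance instGroup : Group (GammaGroup M N) :=
  inferInstanceAs (Group (PresentedGroup (gammaRels M N)))

/-- The generators `g_i` of `Γ_{M,N}`. -/
def gen (i : ZMod M) : GammaGroup M N :=
  PresentedGroup.of (rels := gammaRels M N) i

theorem lift_shift_rels (a : ZMod M) :
    ∀ w ∈ gammaRels M N, FreeGroup.lift (fun i => gen M N (i + a)) w = 1 := by
  have key : ∀ w ∈ gammaRels M N, PresentedGroup.mk (gammaRels M N) w = 1 := fun w hw =>
    PresentedGroup.one_of_mem hw
  rintro w (⟨i, rfl⟩ | ⟨i, j, rfl⟩)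
  · have := key _ (Or.inl ⟨i + a, rfl⟩)
    rw [map_pow] at this ⊢
    rwa [FreeGroup.lift_apply_of]
  · have := key _ (Or.inr ⟨fun t => i t + a, fun t => j t + a, rfl⟩)
    simp only [map_commutatorElement, map_list_prod, List.map_ofFn, Function.comp_def,
      FreeGroup.lift_apply_of] at this ⊢
    exact this

/-- The endomorphism `g_i ↦ g_{i+a}` of `Γ_{M,N}`. -/
def shift (a : ZMod M) : GammaGroup M N →* GammaGroup M N :=
  PresentedGroup.toGroup (lift_shift_rels M N a)

@[simp]
theorem shift_gen (a i : ZMod M) : shift M N a (gen M N i) = gen M N (i + a) :=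
  PresentedGroup.toGroup.of (lift_shift_rels M N a)

theorem hom_ext {G : Type*} [Group G] {φ ψ : GammaGroup M N →* G}
    (h : ∀ i, φ (gen M N i) = ψ (gen M N i)) : φ = ψ :=
  PresentedGroup.ext h

/-- The cyclic action of `ℤ/M` (written multiplicatively) on `Γ_{M,N}`: the class of `a` maps
`g_i` to `g_{i+a}`. -/
instance instMulDistribMulAction :
    MulDistribMulAction (Multiplicative (ZMod M)) (GammaGroup M N) where
  smul a x := shift M N a.toAdd x
  one_smul x := by
    change shift M N 0 x = x
    have : shift M N 0 = MonoidHom.id _ := hom_ext M N fun i => by simp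
    rw [this]
    rfl
  mul_smul a b x := by
    change shift M N (a.toAdd + b.toAdd) x = shift M N a.toAdd (shift M N b.toAdd x)
    have : shift M N (a.toAdd + b.toAdd) = (shift M N a.toAdd).comp (shift M N b.toAdd) :=
      hom_ext M N fun i => by simp [add_comm, add_left_comm]
    rw [this]
    rfl
  smul_mul a x y := map_mul (shift M N a.toAdd) x y
  smul_one a := map_one (shift M N a.toAdd)

theorem smul_gen (a : Multiplicative (ZMod M)) (i : ZMod M) :
    a • gen M N i = gen M N (i + a.toAdd) :=
  shift_gen M N a.toAdd i

end GammaGroup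

end

/-! Write `e_x` for the image of `1 # δ_x` in `A`. The `x` with `e_x ≠ 0` form a submonoid of the
cyclic group `H` of prime order, so either only `e_1` survives, and then `A` is a quotient of a
group algebra and hence cocommutative, or every `e_x`, and with it every `f (r # δ_x)`, is
nonzero. In the second case let `K` be the set of all `r` with `f (r # δ_1) = e_1`. This is an
`H`-stable normal subgroup of `Γ`, and `f (r # δ_x)` is a scalar multiple of `e_x` whenever
`r ∈ K`.

* If `K` is trivial, then applying a functional to the left tensor factor of the summand
  `(r # δ_1) ⊗ (r # δ_x)` of the comultiplication gives operators on `A` that have the elements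
  `f (r # δ_x)` as simultaneous eigenvectors with pairwise distinct eigenvalue systems. So these
  elements are linearly independent and `f` is injective.
* If `K` has finite index in `Γ`, then `A` is finite-dimensional.

It remains to see that every nontrivial `H`-stable normal subgroup `L` of `Γ_{M,N}` has finite
index. The words whose length is divisible by `N` form an abelian normal subgroup `T` with quotient
`ℤ/N`. If `L` is not contained in `T`, then it maps onto `ℤ/N`, so it contains the commutator
subgroup, and the abelianization is finite. If `L` is contained in `T`, we use that `T` is a cyclic
module over `ℤ[X] ⧸ (Φ_p)`, where `X` acts by `h` and `p = M` when `N = 2`, and by conjugation by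
`g_0` and `p = N` when `M = 2`; a nonzero submodule of such a module has finite index.
-/

theorem eq_of_forall_dual_apply_eq (k : Type*) {V : Type*} [Field k] [AddCommGroup V]
    [Module k V] {v w : V} (h : ∀ φ : Module.Dual k V, φ v = φ w) : v = w :=
  sub_eq_zero.1 <| (Module.forall_dual_apply_eq_zero_iff k _).1 fun φ => by
    rw [map_sub, h, sub_self]

theorem injective_of_linearIndependent_comp_basis {R ι M N : Type*} [Ring R] [AddCommGroup M]
    [AddCommGroup N] [Module R M] [Module R N] (b : Module.Basis ι R M) {f : M →ₗ[R] N}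
    (h : LinearIndependent R (f ∘ b)) : Function.Injective f := by
  have hf : f = Finsupp.linearCombination R (f ∘ b) ∘ₗ b.repr := b.ext fun i => by simp
  rw [hf]
  exact (linearIndependent_iff_injective_finsuppLinearCombination.1 h).comp b.repr.injective

/-- Simultaneous eigenvectors are not required to come from commuting operators: words in the
operators act on the eigenvectors through characters of a free monoid, and distinct characters
are linearly independent. -/
theorem linearIndependent_of_simultaneous_eigenvectors {k V ι κ : Type*} [Field k]
    [AddCommGroup V] [Module k V] (E : κ → Module.End k V) {χ : ι → κ → k} {v : ι → V}
    (hχ : Function.Injective χ) (hE : ∀ i j, E j (v i) = χ i j • v i) (hv : ∀ i, v i ≠ 0) :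
    LinearIndependent k v := by
  let character (i : ι) : FreeMonoid κ →* k := FreeMonoid.lift (χ i)
  have character_injective : Function.Injective character := FreeMonoid.lift.injective.comp hχ
  have lift_apply (w : FreeMonoid κ) (i : ι) : FreeMonoid.lift E w (v i) = character i w • v i := by
    induction w using FreeMonoid.inductionOn' with
    | one => simp
    | of_mul j w ih =>
      rw [map_mul, Module.End.mul_apply, ih, map_smul, FreeMonoid.lift_eval_of, hE, smul_smul,
        map_mul, FreeMonoid.lift_eval_of, mul_comm]
  have character_independent :=
    (linearIndependent_monoidHom (FreeMonoid κ) k).comp character character_injective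
  rw [linearIndependent_iff'] at character_independent ⊢
  intro s c hc i hi
  obtain ⟨ψ, hψ⟩ := Module.Projective.exists_dual_ne_zero k (hv i)
  refine (mul_eq_zero.1 (character_independent s (fun j => c j * ψ (v j)) ?_ i hi)).resolve_right hψ
  ext w
  have := congrArg (fun a => ψ (FreeMonoid.lift E w a)) hc
  simpa [lift_apply, mul_assoc, mul_comm] using this

namespace SmashCoproduct

variable {k Γ H : Type*} [Field k] [Group Γ] [Group H] [Fintype H] [DecidableEq H]
  [MulDistribMulAction H Γ] {A : Type*} [Ring A] [Bialgebra k A]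
  (f : SmashCoproduct k Γ H →ₐc[k] A)

theorem map_elt_mul_map_elt (r s : Γ) (x y : H) :
    f (elt k r x) * f (elt k s y) = if x = y then f (elt k (r * s) x) else 0 := by
  rw [← map_mul, elt_mul_elt, apply_ite f, map_zero]

theorem map_elt_mul_map_elt_self (r s : Γ) (x : H) :
    f (elt k r x) * f (elt k s x) = f (elt k (r * s) x) := by
  rw [map_elt_mul_map_elt, if_pos rfl]

theorem comul_map_elt (r : Γ) (x : H) : Coalgebra.comul (R := k) (f (elt k r x)) =
    ∑ l : H, f (elt k r l) ⊗ₜ[k] f (elt k (l⁻¹ • r) (l⁻¹ * x)) := by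
  rw [← CoalgHomClass.map_comp_comul_apply]
  change TensorProduct.map _ _ (comulMap k Γ H _) = _
  simp

theorem map_elt_one_ne_zero (r : Γ) : f (elt k r (1 : H)) ≠ 0 := by
  intro h
  have : Coalgebra.counit (R := k) (f (elt k r (1 : H))) = 1 := by
    rw [CoalgHomClass.counit_comp_apply]
    exact (counitMap_elt k r 1).trans (if_pos rfl)
  simp [h] at this

theorem map_elt_ne_zero {x : H} (h : f (elt k (1 : Γ) x) ≠ 0) (r : Γ) : f (elt k r x) ≠ 0 := by
  intro h0
  apply h
  rw [← mul_inv_cancel r, ← map_elt_mul_map_elt_self, h0, zero_mul]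

theorem span_range_map_elt {f : SmashCoproduct k Γ H →ₐc[k] A} (hf : Function.Surjective f) :
    Submodule.span k (Set.range fun p : Γ × H => f (elt k p.1 p.2)) = ⊤ := by
  have : (Set.range fun p : Γ × H => f (elt k p.1 p.2)) =
      (f : SmashCoproduct k Γ H →ₗ[k] A) '' Set.range (basis k Γ H) := by
    simp [← Set.range_comp, Function.comp_def]
  rw [this, Submodule.span_image, (basis k Γ H).span_eq, Submodule.map_top]
  exact LinearMap.range_eq_top.2 hf

/-- The operator `a ↦ (φ ⊗ id) (Δ(a) (e_l ⊗ e_m))` on `A`, where `e_x` denotes the image of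
`1 # δ_x`. It isolates one summand of the comultiplication of `r # δ_{lm}`. -/
noncomputable def comulSlice (φ : Module.Dual k A) (l m : H) : A →ₗ[k] A :=
  TensorProduct.lid k A ∘ₗ φ.rTensor A ∘ₗ
    LinearMap.mulRight k (f (elt k 1 l) ⊗ₜ[k] f (elt k 1 m)) ∘ₗ Coalgebra.comul

theorem comulSlice_map_elt (φ : Module.Dual k A) (l m : H) (r : Γ) (x : H) :
    comulSlice f φ l m (f (elt k r x)) =
      if x = l * m then φ (f (elt k r l)) • f (elt k (l⁻¹ • r) m) else 0 := by
  have summand_eq_zero : ∀ y ≠ l, f (elt k r y) ⊗ₜ[k] f (elt k (y⁻¹ • r) (y⁻¹ * x)) *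
      f (elt k 1 l) ⊗ₜ[k] f (elt k 1 m) = 0 := fun y hy => by
    rw [Algebra.TensorProduct.tmul_mul_tmul, map_elt_mul_map_elt, if_neg hy,
      TensorProduct.zero_tmul]
  rw [comulSlice, LinearMap.comp_apply, LinearMap.comp_apply, LinearMap.comp_apply, comul_map_elt,
    LinearMap.mulRight_apply, Finset.sum_mul, Fintype.sum_eq_single l summand_eq_zero,
    Algebra.TensorProduct.tmul_mul_tmul, map_elt_mul_map_elt_self, map_elt_mul_map_elt, mul_one,
    mul_one]
  simp only [inv_mul_eq_iff_eq_mul]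
  split_ifs with h
  · simp [h]
  · simp

theorem comulSlice_map_elt_mul (φ : Module.Dual k A) (l m : H) (r : Γ) :
    comulSlice f φ l m (f (elt k r (l * m))) = φ (f (elt k r l)) • f (elt k (l⁻¹ • r) m) := by
  rw [comulSlice_map_elt, if_pos rfl]

/-- The submonoid of those `x : H` for which `1 # δ_x` survives in `A`. -/
def supportSubmonoid : Submonoid H where
  carrier := {x | f (elt k (1 : Γ) x) ≠ 0}
  one_mem' := map_elt_one_ne_zero f 1
  mul_mem' {x y} hx hy h := by
    obtain ⟨φ, hφ⟩ := Module.Projective.exists_dual_ne_zero k hx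
    have := comulSlice_map_elt_mul f φ x y 1
    rw [h, map_zero, smul_one] at this
    exact smul_ne_zero hφ hy this.symm

variable {f}

theorem isCocomm_of_map_elt_eq_zero (hf : Function.Surjective f)
    (h : ∀ x : H, x ≠ 1 → f (elt k (1 : Γ) x) = 0) : Coalgebra.IsCocomm k A := by
  have map_elt_eq_zero (r : Γ) {x : H} (hx : x ≠ 1) : f (elt k r x) = 0 := by
    rw [← mul_one r, ← map_elt_mul_map_elt_self, h x hx, mul_zero]
  refine ⟨LinearMap.ext_on_range (span_range_map_elt hf) fun ⟨r, x⟩ => ?_⟩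
  simp only [LinearMap.comp_apply, LinearEquiv.coe_coe]
  rcases eq_or_ne x 1 with rfl | hx
  · have : Coalgebra.comul (R := k) (f (elt k r (1 : H))) =
        f (elt k r 1) ⊗ₜ[k] f (elt k r 1) := by
      rw [comul_map_elt, Fintype.sum_eq_single 1 fun l hl => by
        rw [map_elt_eq_zero r hl, TensorProduct.zero_tmul]]
      simp
    rw [this, TensorProduct.comm_tmul]
  · rw [map_elt_eq_zero r hx, map_zero, map_zero]

theorem map_elt_ne_zero_of_not_isCocomm (hH : (Nat.card H).Prime) (hf : Function.Surjective f)
    (hcocomm : ¬ Coalgebra.IsCocomm k A) (r : Γ) (x : H) : f (elt k r x) ≠ 0 := by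
  obtain ⟨y, hy1, hy⟩ : ∃ y : H, y ≠ 1 ∧ f (elt k (1 : Γ) y) ≠ 0 := by
    by_contra! h
    exact hcocomm (isCocomm_of_map_elt_eq_zero hf h)
  have : Fact (Nat.card H).Prime := ⟨hH⟩
  have hx : x ∈ supportSubmonoid f :=
    Submonoid.powers_le.2 hy (mem_powers_of_prime_card rfl hy1)
  exact map_elt_ne_zero f hx r

variable (f)

/-- The kernel of `r ↦ f (r # δ_1)`, viewed as a homomorphism from `Γ` to the units of the
corner of `A` cut out by the idempotent `f (1 # δ_1)`. -/
def groupKer : Subgroup Γ where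
  carrier := {r | f (elt k r (1 : H)) = f (elt k 1 1)}
  one_mem' := rfl
  mul_mem' {r s} hr hs := by
    rw [Set.mem_ofPred_eq] at hr hs ⊢
    rw [← map_elt_mul_map_elt_self, hr, hs, map_elt_mul_map_elt_self, mul_one]
  inv_mem' {r} hr := by
    rw [Set.mem_ofPred_eq] at hr ⊢
    rw [← one_mul r⁻¹, ← map_elt_mul_map_elt_self, ← hr, map_elt_mul_map_elt_self,
      mul_inv_cancel, hr]

theorem mem_groupKer {r : Γ} : r ∈ groupKer f ↔ f (elt k r (1 : H)) = f (elt k 1 1) := Iff.rfl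

theorem inv_mul_mem_groupKer {r s : Γ} :
    r⁻¹ * s ∈ groupKer f ↔ f (elt k r (1 : H)) = f (elt k s 1) := by
  rw [mem_groupKer]
  constructor <;> intro h
  · rw [← mul_inv_cancel_left r s, ← map_elt_mul_map_elt_self, h, map_elt_mul_map_elt_self,
      mul_one]
  · rw [← map_elt_mul_map_elt_self, ← h, map_elt_mul_map_elt_self, inv_mul_cancel]

instance groupKer_normal : (groupKer f).Normal where
  conj_mem r hr s := by
    rw [mem_groupKer] at hr ⊢
    rw [← map_elt_mul_map_elt_self, ← map_elt_mul_map_elt_self, hr, map_elt_mul_map_elt_self,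
      mul_one, map_elt_mul_map_elt_self, mul_inv_cancel]

variable {f} (hne : ∀ (r : Γ) (x : H), f (elt k r x) ≠ 0)
include hne

theorem exists_map_elt_smul_eq_smul {r : Γ} (hr : r ∈ groupKer f) (x : H) :
    ∃ c : k, f (elt k (x • r) x) = c • f (elt k 1 x) := by
  obtain ⟨φ, hφ⟩ := Module.Projective.exists_dual_ne_zero k (hne r x⁻¹)
  have hslice := comulSlice_map_elt_mul f φ x⁻¹ x
  have := hslice r
  rw [inv_mul_cancel, (mem_groupKer f).1 hr, ← inv_mul_cancel x, hslice, smul_one, inv_inv] at this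
  exact ⟨_, (eq_inv_smul_iff₀ hφ).2 this.symm |>.trans (smul_smul _ _ _)⟩

theorem smul_mem_groupKer (x : H) {r : Γ} (hr : r ∈ groupKer f) : x • r ∈ groupKer f := by
  obtain ⟨c, hc⟩ := exists_map_elt_smul_eq_smul hne hr x
  refine (mem_groupKer f).2 (eq_of_forall_dual_apply_eq k fun φ => ?_)
  have hslice (s : Γ) : comulSlice f φ 1 x (f (elt k s x)) = φ (f (elt k s 1)) • f (elt k s x) := by
    simp [comulSlice_map_elt]
  have := hslice (x • r)
  rw [hc, map_smul, hslice, smul_comm c, ← hc] at this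
  exact (smul_left_injective k (hne (x • r) x) this).symm

theorem exists_map_elt_eq_smul {r : Γ} (hr : r ∈ groupKer f) (x : H) :
    ∃ c : k, f (elt k r x) = c • f (elt k 1 x) := by
  simpa using exists_map_elt_smul_eq_smul hne (smul_mem_groupKer hne x⁻¹ hr) x

theorem finite_of_finite_quotient_groupKer (hf : Function.Surjective f)
    [Finite (Γ ⧸ groupKer f)] : Module.Finite k A := by
  let b (p : (Γ ⧸ groupKer f) × H) : A := f (elt k p.1.out p.2)
  refine ⟨Submodule.fg_def.2 ⟨Set.range b, Set.finite_range b, ?_⟩⟩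
  rw [eq_top_iff, ← span_range_map_elt hf, Submodule.span_le]
  rintro _ ⟨⟨r, x⟩, rfl⟩
  set s := (r : Γ ⧸ groupKer f).out
  obtain ⟨c, hc⟩ := exists_map_elt_eq_smul hne
    (QuotientGroup.eq.1 (Quotient.out_eq' (r : Γ ⧸ groupKer f))) x
  have : f (elt k r x) = c • b (r, x) := calc
    f (elt k r x) = f (elt k s x) * f (elt k (s⁻¹ * r) x) := by
      rw [map_elt_mul_map_elt_self, mul_inv_cancel_left]
    _ = c • b (r, x) := by rw [hc, mul_smul_comm, map_elt_mul_map_elt_self, mul_one]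
  change f (elt k r x) ∈ _
  rw [this]
  exact Submodule.smul_mem _ _ (Submodule.subset_span ⟨_, rfl⟩)

theorem linearIndependent_map_elt (hker : groupKer f = ⊥) :
    LinearIndependent k fun p : Γ × H => f (elt k p.1 p.2) := by
  let χ (p : Γ × H) (q : Module.Dual k A × H) : k := if p.2 = q.2 then q.1 (f (elt k p.1 1)) else 0
  have χ_injective : Function.Injective χ := by
    rintro ⟨r, x⟩ ⟨s, y⟩ h
    have h (φ : Module.Dual k A) :
        φ (f (elt k r 1)) = if y = x then φ (f (elt k s 1)) else 0 := by
      simpa [χ] using congrFun h (φ, x)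
    obtain ⟨φ, hφ⟩ := Module.Projective.exists_dual_ne_zero k (hne r 1)
    obtain rfl : y = x := by
      by_contra hyx
      exact hφ ((h φ).trans (if_neg hyx))
    have : r⁻¹ * s ∈ groupKer f := (inv_mul_mem_groupKer f).2 <|
      eq_of_forall_dual_apply_eq k fun φ => (h φ).trans (if_pos rfl)
    rw [hker, Subgroup.mem_bot, inv_mul_eq_one] at this
    rw [this]
  refine linearIndependent_of_simultaneous_eigenvectors (fun q => comulSlice f q.1 1 q.2)
    χ_injective (fun p q => ?_) fun p => hne p.1 p.2
  simp only [χ, comulSlice_map_elt, one_mul, inv_one, one_smul]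
  split_ifs with h
  · rw [h]
  · rw [zero_smul]

theorem injective_of_groupKer_eq_bot (hker : groupKer f = ⊥) : Function.Injective f := by
  refine injective_of_linearIndependent_comp_basis (basis k Γ H) (f := (f : _ →ₗ[k] A)) ?_
  simpa [Function.comp_def] using linearIndependent_map_elt hne hker

omit hne

theorem injective_of_prime_card (hH : (Nat.card H).Prime)
    (hΓ : ∀ L : Subgroup Γ, L.Normal → (∀ x : H, ∀ r ∈ L, x • r ∈ L) → L ≠ ⊥ → L.FiniteIndex)
    (hf : Function.Surjective f) (hinf : ¬ Module.Finite k A)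
    (hcocomm : ¬ Coalgebra.IsCocomm k A) : Function.Injective f := by
  have hne := map_elt_ne_zero_of_not_isCocomm hH hf hcocomm
  refine injective_of_groupKer_eq_bot hne (by_contra fun hker => ?_)
  have := hΓ (groupKer f) inferInstance (fun x _ hr => smul_mem_groupKer hne x hr) hker
  exact hinf (finite_of_finite_quotient_groupKer hne hf)

end SmashCoproduct

section FiniteQuotients

open Polynomial
open scoped IsMulCommutative

theorem finite_quotient_of_span_singleton_eq_top {R M : Type*} [CommRing R] [AddCommGroup M]
    [Module R M] {J : Ideal R} [Ring.HasFiniteQuotients (R ⧸ J)] {τ : M}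
    (hτ : Submodule.span R {τ} = ⊤) (hJ : J ≤ Ideal.torsionOf R M τ) {L : Submodule R M}
    (hL : L ≠ ⊥) : Finite (M ⧸ L) := by
  let I : Ideal R := L.comap (LinearMap.toSpanSingleton R M τ)
  have toSpanSingleton_surjective : Function.Surjective (LinearMap.toSpanSingleton R M τ) := by
    rw [← LinearMap.range_eq_top, LinearMap.range_toSpanSingleton, hτ]
  have hJI : J ≤ I := fun a ha => by
    rw [Submodule.mem_comap, LinearMap.toSpanSingleton_apply,
      (Ideal.mem_torsionOf_iff τ a).1 (hJ ha)]
    exact L.zero_mem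
  have hI : I.map (Ideal.Quotient.mk J) ≠ ⊥ := by
    obtain ⟨u, huL, hu⟩ := L.exists_mem_ne_zero_of_ne_bot hL
    obtain ⟨a, rfl⟩ := toSpanSingleton_surjective u
    refine fun h => hu ((Ideal.mem_torsionOf_iff τ a).1 (hJ ?_))
    have : Ideal.Quotient.mk J a ∈ I.map (Ideal.Quotient.mk J) := Ideal.mem_map_of_mem _ huL
    rwa [h, Ideal.mem_bot, Ideal.Quotient.eq_zero_iff_mem] at this
  have : Finite ((R ⧸ J) ⧸ I.map (Ideal.Quotient.mk J)) := Ring.HasFiniteQuotients.finiteQuotient hI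
  have : Finite (R ⧸ I) := Finite.of_equiv _ (DoubleQuot.quotQuotEquivQuotOfLE hJI).toEquiv
  exact Finite.of_surjective (Submodule.mapQ I L (LinearMap.toSpanSingleton R M τ) le_rfl)
    (.of_comp (g := I.mkQ) (L.mkQ_surjective.comp toSpanSingleton_surjective))

theorem finite_quotient_of_cyclic_of_irreducible {T : Type*} [AddCommGroup T] (φ : Module.End ℤ T)
    {τ : T} (hgen : ∀ S : Submodule ℤ T, τ ∈ S → S ≤ S.comap φ → S = ⊤) {P : ℤ[X]}
    (hmonic : P.Monic) (hirr : Irreducible P) (hP : aeval φ P τ = 0) {L : Submodule ℤ T}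
    (hLφ : L ≤ L.comap φ) (hL : L ≠ ⊥) : Finite (T ⧸ L) := by
  let toAEval : (Algebra.lsmul ℤ ℤ T φ).invtSubmodule ≃o Submodule ℤ[X] (Module.AEval' φ) :=
    Module.AEval.mapSubmodule ℤ T φ
  have hspan : Submodule.span ℤ[X] {Module.AEval'.of φ τ} = ⊤ := by
    let S := toAEval.symm (Submodule.span ℤ[X] {Module.AEval'.of φ τ})
    have hS : (S : Submodule ℤ T) = ⊤ :=
      hgen S (Submodule.mem_span_singleton_self (Module.AEval'.of φ τ)) S.2
    exact Submodule.eq_top_iff'.2 fun t => Submodule.eq_top_iff'.1 hS ((Module.AEval'.of φ).symm t)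
  have : (Ideal.span {P}).IsPrime := (Ideal.span_singleton_prime hmonic.ne_zero).2 hirr.prime
  have : Module.Finite ℤ (ℤ[X] ⧸ Ideal.span {P}) := hmonic.finite_quotient
  have hP' : Ideal.span {P} ≤ Ideal.torsionOf ℤ[X] _ (Module.AEval'.of φ τ) := by
    rw [Ideal.span_singleton_le_iff_mem, Ideal.mem_torsionOf_iff]
    exact hP
  have hL' : toAEval ⟨L, hLφ⟩ ≠ ⊥ := by
    obtain ⟨u, huL, hu⟩ := L.exists_mem_ne_zero_of_ne_bot hL
    exact fun h => hu ((Submodule.eq_bot_iff _).1 h (Module.AEval'.of φ u) ⟨u, huL, rfl⟩)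
  have := finite_quotient_of_span_singleton_eq_top hspan hP' hL'
  have e : (T ⧸ L) ≃ₗ[ℤ] (Module.AEval' φ ⧸ (toAEval ⟨L, hLφ⟩).restrictScalars ℤ) :=
    Submodule.Quotient.equiv L _ (Module.AEval'.of φ) rfl
  exact Finite.of_equiv _ ((e.trans (Submodule.Quotient.restrictScalarsEquiv ℤ _)).symm.toEquiv)

theorem finiteIndex_of_cyclic {T : Type*} [CommGroup T] (φ : T →* T) {τ : T}
    (hgen : ∀ S : Subgroup T, τ ∈ S → S ≤ S.comap φ → S = ⊤) {p : ℕ} (hp : p.Prime)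
    (hnorm : ∏ j ∈ Finset.range p, φ^[j] τ = 1) {L : Subgroup T} (hLφ : L ≤ L.comap φ)
    (hL : L ≠ ⊥) : L.FiniteIndex := by
  let Φ : Module.End ℤ (Additive T) := (MonoidHom.toAdditive φ).toIntLinearMap
  have pow_apply (j : ℕ) (t : T) : (Φ ^ j) (.ofMul t) = .ofMul (φ^[j] t) := by
    rw [Module.End.pow_apply]
    have : Function.Semiconj Additive.ofMul φ Φ := fun _ => rfl
    exact (this.iterate_right j t).symm
  let toSubmodule := Subgroup.toAddSubgroup.trans (AddSubgroup.toIntSubmodule (M := Additive T))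
  have hgen' (S : Submodule ℤ (Additive T)) (hτ : .ofMul τ ∈ S) (hS : S ≤ S.comap Φ) : S = ⊤ := by
    have := hgen (toSubmodule.symm S) hτ hS
    rwa [OrderIso.symm_apply_eq, OrderIso.map_top] at this
  have hΦ : Polynomial.aeval Φ (cyclotomic p ℤ) (.ofMul τ) = 0 := by
    have : Fact p.Prime := ⟨hp⟩
    simp only [cyclotomic_prime, map_sum, map_pow, aeval_X, LinearMap.sum_apply, pow_apply,
      ← ofMul_prod, hnorm, ofMul_one]
  have : Finite (Additive T ⧸ toSubmodule L) :=
    finite_quotient_of_cyclic_of_irreducible Φ hgen' (cyclotomic.monic p ℤ)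
      (cyclotomic.irreducible hp.pos) hΦ hLφ (by rwa [Ne, map_eq_bot_iff])
  have : Finite (T ⧸ L) := this
  exact L.finiteIndex_of_finite_quotient

/-- The hypotheses say that `T` is a cyclic module over `ℤ[X] ⧸ (1 + X + ⋯ + X ^ (p - 1))`. This
ring is an order in the `p`-th cyclotomic field, so all of its proper quotients are finite. -/
theorem relIndex_ne_zero_of_cyclic {G : Type*} [Group G] {T L : Subgroup G} [IsMulCommutative T]
    (φ : G →* G) (hTφ : T ≤ T.comap φ) (hLφ : L ≤ L.comap φ) {τ : G} (hτ : τ ∈ T)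
    (hgen : ∀ S : Subgroup G, τ ∈ S → S ≤ S.comap φ → T ≤ S) {p : ℕ} (hp : p.Prime)
    (hnorm : ((List.range p).map fun j => φ^[j] τ).prod = 1) (hL : L ⊓ T ≠ ⊥) :
    L.relIndex T ≠ 0 := by
  let φT : T →* T := φ.restrict hTφ
  have coe_iterate (j : ℕ) (t : T) : ((φT^[j] t : T) : G) = φ^[j] t :=
    Function.Semiconj.iterate_right (f := T.subtype) (fun _ => rfl) j t
  have hgen' (S : Subgroup T) (hτS : ⟨τ, hτ⟩ ∈ S) (hS : S ≤ S.comap φT) : S = ⊤ := by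
    refine (Subgroup.eq_top_iff' S).2 fun t => ?_
    obtain ⟨s, hs, hst⟩ := hgen (S.map T.subtype) ⟨_, hτS, rfl⟩
      (Subgroup.map_le_iff_le_comap.2 fun s hs => ⟨φT s, hS hs, rfl⟩) t.2
    rwa [← Subtype.ext hst]
  have hnorm' : ∏ j ∈ Finset.range p, φT^[j] ⟨τ, hτ⟩ = 1 := by
    change ((List.range p).map fun j => φT^[j] ⟨τ, hτ⟩).prod = 1
    refine Subtype.ext (((T.subtype.map_list_prod _).trans ?_).trans hnorm)
    simp only [List.map_map, Function.comp_def, Subgroup.subtype_apply, coe_iterate]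
  have hL' : L.subgroupOf T ≠ ⊥ := by
    rwa [Ne, Subgroup.subgroupOf_eq_bot, disjoint_iff]
  have := finiteIndex_of_cyclic φT hgen' hp hnorm' (L := L.subgroupOf T) (fun t ht => hLφ ht) hL'
  exact this.index_ne_zero

end FiniteQuotients

theorem prod_iterate_conj {G : Type*} [Group G] (a b : G) (m : ℕ) :
    ((List.range m).map fun j => (MulAut.conj a)^[j] (b * a⁻¹)).prod = b ^ m * (a ^ m)⁻¹ := by
  have iterate_conj (j : ℕ) : (MulAut.conj a)^[j] (b * a⁻¹) = a ^ j * (b * a⁻¹) * (a ^ j)⁻¹ := by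
    induction j with
    | zero => simp
    | succ j ih => rw [Function.iterate_succ_apply', ih, MulAut.conj_apply, pow_succ']; group
  induction m with
  | zero => simp
  | succ m ih =>
    rw [List.range_succ, List.map_append, List.prod_append, ih, List.map_singleton,
      List.prod_singleton, iterate_conj, pow_succ, pow_succ]
    group

namespace GammaGroup

variable (M N : ℕ)

theorem gen_pow (i : ZMod M) : gen M N i ^ N = 1 := by
  have := PresentedGroup.one_of_mem (rels := gammaRels M N) (Or.inl ⟨i, rfl⟩)
  rwa [map_pow] at this

/-- The product `g_{i_1} ⋯ g_{i_n}` in `Γ_{M,N}`, for a list `[i_1, …, i_n]` of indices. -/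
def word (l : List (ZMod M)) : GammaGroup M N := (l.map (gen M N)).prod

theorem word_cons (i : ZMod M) (l : List (ZMod M)) :
    word M N (i :: l) = gen M N i * word M N l :=
  List.prod_cons

theorem word_append (l l' : List (ZMod M)) :
    word M N (l ++ l') = word M N l * word M N l' := by
  rw [word, List.map_append, List.prod_append, word, word]

theorem word_comm {l l' : List (ZMod M)} (hl : l.length = N) (hl' : l'.length = N) :
    word M N l * word M N l' = word M N l' * word M N l := by
  have ofFn_eq_map {m : List (ZMod M)} (hm : m.length = N) :
      (List.ofFn fun t => FreeGroup.of (m.get (t.cast hm.symm))) = m.map FreeGroup.of :=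
    List.ext_getElem (by simp [hm]) fun n _ _ => by simp
  have := PresentedGroup.one_of_mem (rels := gammaRels M N)
    (Or.inr ⟨fun t => l.get (t.cast hl.symm), fun t => l'.get (t.cast hl'.symm), rfl⟩)
  rwa [ofFn_eq_map hl, ofFn_eq_map hl', map_commutatorElement,
    commutatorElement_eq_one_iff_mul_comm, map_list_prod, map_list_prod, List.map_map,
    List.map_map] at this

theorem exists_word_eq [NeZero N] (g : GammaGroup M N) : ∃ l, word M N l = g := by
  have isOfFinOrder_gen : ∀ x ∈ Set.range (gen M N), IsOfFinOrder x := by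
    rintro _ ⟨i, rfl⟩
    exact isOfFinOrder_iff_pow_eq_one.2 ⟨N, NeZero.pos N, gen_pow M N i⟩
  have hg : g ∈ Submonoid.closure (Set.range (gen M N)) := by
    rw [← Subgroup.closure_toSubmonoid_of_isOfFinOrder isOfFinOrder_gen]
    exact (PresentedGroup.closure_range_of (gammaRels M N)).ge (Subgroup.mem_top g)
  obtain ⟨w, hw, rfl⟩ := Submonoid.exists_list_of_mem_closure hg
  obtain ⟨l, rfl⟩ := (Set.range_list_map (gen M N)).ge hw
  exact ⟨l, rfl⟩

/-- The homomorphism `Γ_{M,N} → ℤ/N` that sends every generator to `1`, i.e. the length of words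
modulo `N`. Its kernel is the abelian normal subgroup of translations. -/
def degree : GammaGroup M N →* Multiplicative (ZMod N) :=
  PresentedGroup.toGroup (f := fun _ => Multiplicative.ofAdd 1) <| by
    rintro _ (⟨i, rfl⟩ | ⟨i, j, rfl⟩)
    · rw [map_pow, FreeGroup.lift_apply_of, ← ofAdd_nsmul, nsmul_one, ZMod.natCast_self, ofAdd_zero]
    · rw [map_commutatorElement, commutatorElement_eq_one_iff_mul_comm, mul_comm]

theorem degree_gen (i : ZMod M) : degree M N (gen M N i) = Multiplicative.ofAdd 1 :=
  PresentedGroup.toGroup.of _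

theorem degree_shift (a : ZMod M) (g : GammaGroup M N) :
    degree M N (shift M N a g) = degree M N g := by
  have : (degree M N).comp (shift M N a) = degree M N :=
    hom_ext M N fun i => by simp [degree_gen]
  exact DFunLike.congr_fun this g

theorem degree_word (l : List (ZMod M)) :
    degree M N (word M N l) = Multiplicative.ofAdd (l.length : ZMod N) := by
  induction l with
  | nil => simp [word]
  | cons i l ih =>
    rw [word_cons, map_mul, degree_gen, ih, ← ofAdd_add, List.length_cons, Nat.cast_succ, add_comm]

theorem word_mem_ker_degree {l : List (ZMod M)} :
    word M N l ∈ (degree M N).ker ↔ N ∣ l.length := by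
  rw [MonoidHom.mem_ker, degree_word, ofAdd_eq_one, ZMod.natCast_eq_zero_iff]

theorem word_mem_closure {l : List (ZMod M)} (hl : N ∣ l.length) :
    word M N l ∈ Subgroup.closure (word M N '' {l | l.length = N}) := by
  obtain ⟨c, hc⟩ := hl
  induction c generalizing l with
  | zero =>
    rw [List.length_eq_zero_iff.1 hc]
    exact one_mem _
  | succ c ih =>
    rw [← List.take_append_drop N l, word_append]
    refine mul_mem (Subgroup.subset_closure ⟨_, ?_, rfl⟩) (ih ?_)
    · rw [Set.mem_ofPred_eq, List.length_take, hc, Nat.mul_succ, min_eq_left (N.le_add_left _)]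
    · rw [List.length_drop, hc, Nat.mul_succ, Nat.add_sub_cancel]

theorem ker_degree_eq_closure [NeZero N] :
    (degree M N).ker = Subgroup.closure (word M N '' {l | l.length = N}) := by
  refine le_antisymm (fun g hg => ?_) ((Subgroup.closure_le _).2 ?_)
  · obtain ⟨l, rfl⟩ := exists_word_eq M N g
    exact word_mem_closure M N ((word_mem_ker_degree M N).1 hg)
  · rintro _ ⟨l, hl, rfl⟩
    exact (word_mem_ker_degree M N).2 hl.symm.dvd

instance isMulCommutative_ker_degree [NeZero N] : IsMulCommutative (degree M N).ker := by
  rw [ker_degree_eq_closure]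
  refine Subgroup.isMulCommutative_closure ?_
  rintro _ ⟨l, hl, rfl⟩ _ ⟨l', hl', rfl⟩
  exact word_comm M N hl hl'

instance finite_abelianization [NeZero M] [NeZero N] :
    Finite (Abelianization (GammaGroup M N)) := by
  have : Group.FG (GammaGroup M N) := Group.fg_iff.2
    ⟨Set.range (gen M N), PresentedGroup.closure_range_of (gammaRels M N), Set.finite_range _⟩
  have of_surjective : Function.Surjective (Abelianization.of (G := GammaGroup M N)) :=
    QuotientGroup.mk_surjective
  have := Group.fg_of_surjective of_surjective
  have pow_of_eq_one : (powMonoidHom N).comp Abelianization.of =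
      (1 : GammaGroup M N →* Abelianization (GammaGroup M N)) :=
    hom_ext M N fun i => by
      rw [MonoidHom.comp_apply, powMonoidHom_apply, ← map_pow, gen_pow, map_one,
        MonoidHom.one_apply]
  refine CommGroup.finite_of_fg_isMulTorsion _ fun x => ?_
  obtain ⟨g, rfl⟩ := of_surjective x
  exact isOfFinOrder_iff_pow_eq_one.2 ⟨N, NeZero.pos N, DFunLike.congr_fun pow_of_eq_one g⟩

variable {M N}

theorem finiteIndex_of_not_le_ker_degree [NeZero M] (hN : N.Prime) {L : Subgroup (GammaGroup M N)}
    [L.Normal] (hL : ¬ L ≤ (degree M N).ker) : L.FiniteIndex := by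
  have : NeZero N := ⟨hN.ne_zero⟩
  have : Fact (Nat.card (Multiplicative (ZMod N))).Prime := ⟨by simpa using hN⟩
  have map_degree_eq_top : L.map (degree M N) = ⊤ :=
    (Subgroup.eq_bot_or_eq_top_of_prime_card _).resolve_left fun h =>
      hL ((Subgroup.map_eq_bot_iff _).1 h)
  have sup_ker_eq_top : L ⊔ (degree M N).ker = ⊤ := by
    rw [← Subgroup.comap_map_eq, map_degree_eq_top, Subgroup.comap_top]
  have commutator_le : commutator (GammaGroup M N) ≤ L :=
    Subgroup.Normal.commutator_le_of_self_sup_commutative_eq_top sup_ker_eq_top inferInstance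
  have : Finite (GammaGroup M N ⧸ commutator (GammaGroup M N)) := finite_abelianization M N
  have := (commutator (GammaGroup M N)).finiteIndex_of_finite_quotient
  exact Subgroup.finiteIndex_of_le commutator_le

theorem gen_mul_self (i : ZMod M) : gen M 2 i * gen M 2 i = 1 := by
  rw [← sq, gen_pow]

theorem prod_iterate_shift (m : ℕ) :
    ((List.range m).map fun j => (shift M 2 1)^[j] (gen M 2 0 * gen M 2 1)).prod =
      gen M 2 0 * gen M 2 m := by
  have iterate_shift (j : ℕ) :
      (shift M 2 1)^[j] (gen M 2 0 * gen M 2 1) = gen M 2 j * gen M 2 (j + 1 : ℕ) := by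
    induction j with
    | zero => simp
    | succ j ih => rw [Function.iterate_succ_apply', ih, map_mul, shift_gen, shift_gen]; simp
  induction m with
  | zero => simp [gen_mul_self]
  | succ m ih =>
    rw [List.range_succ, List.map_append, List.prod_append, ih, List.map_singleton,
      List.prod_singleton, iterate_shift, mul_assoc, ← mul_assoc (gen M 2 m), gen_mul_self, one_mul]

theorem relIndex_ker_degree_ne_zero_of_shift (hM : M.Prime) {L : Subgroup (GammaGroup M 2)}
    (hL : L ≤ L.comap (shift M 2 1)) (hbot : L ⊓ (degree M 2).ker ≠ ⊥) :
    L.relIndex (degree M 2).ker ≠ 0 := by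
  have mem_of_stable {S : Subgroup (GammaGroup M 2)} (hτ : gen M 2 0 * gen M 2 1 ∈ S)
      (hS : S ≤ S.comap (shift M 2 1)) (i : ZMod M) : gen M 2 0 * gen M 2 i ∈ S := by
    have : NeZero M := ⟨hM.ne_zero⟩
    have iterate_mem : ∀ j : ℕ, (shift M 2 1)^[j] (gen M 2 0 * gen M 2 1) ∈ S :=
      fun j =>
      Set.MapsTo.iterate (f := shift M 2 1) (s := S) (fun _ h => hS h) j hτ
    rw [← ZMod.natCast_zmod_val i, ← prod_iterate_shift]
    refine list_prod_mem fun x hx => ?_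
    obtain ⟨j, -, rfl⟩ := List.mem_map.1 hx
    exact iterate_mem j
  refine relIndex_ne_zero_of_cyclic (shift M 2 1) (fun t ht => ?_) hL
    (τ := gen M 2 0 * gen M 2 1) ?_ (fun S hτ hS => ?_) hM ?_ hbot
  · exact (degree_shift M 2 1 t).trans ht
  · simpa [word] using word_mem_ker_degree M 2 (l := [0, 1])
  · rw [ker_degree_eq_closure, Subgroup.closure_le]
    rintro _ ⟨l, hl, rfl⟩
    obtain ⟨i, j, rfl⟩ := List.length_eq_two.1 hl
    have := mul_mem (inv_mem (mem_of_stable hτ hS i)) (mem_of_stable hτ hS j)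
    rw [mul_inv_rev, mul_assoc, inv_mul_cancel_left,
      inv_eq_of_mul_eq_one_left (gen_mul_self i)] at this
    simpa [word] using this
  · rw [prod_iterate_shift, ZMod.natCast_self, gen_mul_self]

theorem word_mul_inv_mem_of_conj {S : Subgroup (GammaGroup 2 N)}
    (hτ : gen 2 N 1 * (gen 2 N 0)⁻¹ ∈ S)
    (hS : S ≤ S.comap (MulAut.conj (gen 2 N 0)).toMonoidHom) (l : List (ZMod 2)) :
    word 2 N l * (gen 2 N 0 ^ l.length)⁻¹ ∈ S := by
  induction l with
  | nil => simp [word, one_mem]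
  | cons i l ih =>
    have cons_eq : word 2 N (i :: l) * (gen 2 N 0 ^ (i :: l).length)⁻¹ = gen 2 N i * (gen 2 N 0)⁻¹ *
        MulAut.conj (gen 2 N 0) (word 2 N l * (gen 2 N 0 ^ l.length)⁻¹) := by
      rw [word_cons, MulAut.conj_apply, List.length_cons, pow_succ']
      group
    rw [cons_eq]
    refine mul_mem ?_ (hS ih)
    match i with
    | 0 => exact (mul_inv_cancel (gen 2 N 0)).symm ▸ one_mem S
    | 1 => exact hτ

theorem relIndex_ker_degree_ne_zero_of_conj (hN : N.Prime) {L : Subgroup (GammaGroup 2 N)}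
    [L.Normal] (hbot : L ⊓ (degree 2 N).ker ≠ ⊥) : L.relIndex (degree 2 N).ker ≠ 0 := by
  have : NeZero N := ⟨hN.ne_zero⟩
  refine relIndex_ne_zero_of_cyclic (MulAut.conj (gen 2 N 0)).toMonoidHom
    (fun t ht => Subgroup.Normal.conj_mem inferInstance t ht _)
    (fun t ht => Subgroup.Normal.conj_mem inferInstance t ht _)
    (τ := gen 2 N 1 * (gen 2 N 0)⁻¹) ?_ (fun S hτ hS t ht => ?_) hN ?_ hbot
  · rw [MonoidHom.mem_ker, map_mul, map_inv, degree_gen, degree_gen, mul_inv_cancel]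
  · obtain ⟨l, rfl⟩ := exists_word_eq 2 N t
    have := word_mul_inv_mem_of_conj hτ hS l
    obtain ⟨c, hc⟩ := (word_mem_ker_degree 2 N).1 ht
    rwa [hc, pow_mul, gen_pow, one_pow, inv_one, mul_one] at this
  · exact (prod_iterate_conj _ _ N).trans (by rw [gen_pow, gen_pow, inv_one, mul_one])

theorem finiteIndex_of_ne_bot [NeZero M] (hMN : (N = 2 ∧ M.Prime) ∨ (M = 2 ∧ N.Prime))
    {L : Subgroup (GammaGroup M N)} [L.Normal]
    (hL : ∀ a : Multiplicative (ZMod M), ∀ g ∈ L, a • g ∈ L) (hbot : L ≠ ⊥) : L.FiniteIndex := by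
  have hN : N.Prime := by
    rcases hMN with ⟨rfl, -⟩ | ⟨-, h⟩
    exacts [Nat.prime_two, h]
  have : NeZero N := ⟨hN.ne_zero⟩
  by_cases hle : L ≤ (degree M N).ker
  · have hinf : L ⊓ (degree M N).ker ≠ ⊥ := by rwa [inf_eq_left.2 hle]
    have hrel : L.relIndex (degree M N).ker ≠ 0 := by
      rcases hMN with ⟨rfl, hM⟩ | ⟨rfl, -⟩
      · exact relIndex_ker_degree_ne_zero_of_shift hM (hL (Multiplicative.ofAdd 1)) hinf
      · exact relIndex_ker_degree_ne_zero_of_conj hN hinf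
    refine ⟨?_⟩
    rw [← Subgroup.relIndex_mul_index hle]
    exact mul_ne_zero hrel Subgroup.FiniteIndex.index_ne_zero
  · exact finiteIndex_of_not_le_ker_degree hN hle

end GammaGroup

theorem theorem3p4_general {k : Type*} [Field k] (M N : ℕ) [NeZero M]
    (hMN : (N = 2 ∧ M.Prime) ∨ (M = 2 ∧ N.Prime))
    {A : Type*} [Ring A] [Bialgebra k A]
    (f : SmashCoproduct k (GammaGroup M N) (Multiplicative (ZMod M)) →ₐc[k] A)
    (hf : Function.Surjective f)
    (hinf : ¬ Module.Finite k A)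
    (hcocomm : ¬ Coalgebra.IsCocomm k A) :
    ∃ e : SmashCoproduct k (GammaGroup M N) (Multiplicative (ZMod M)) ≃ₐc[k] A,
      ∀ x, e x = f x := by
  have hM : M.Prime := by
    rcases hMN with ⟨-, h⟩ | ⟨rfl, -⟩
    exacts [h, Nat.prime_two]
  have hinj : Function.Injective f :=
    SmashCoproduct.injective_of_prime_card (by simpa using hM)
      (fun L _ hL hbot => GammaGroup.finiteIndex_of_ne_bot hMN hL hbot) hf hinf hcocomm
  exact ⟨BialgEquiv.ofBijective f ⟨hinj, hf⟩, fun _ => rfl⟩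

theorem theorem3p4 {k : Type*} [Field k] (M N : ℕ) [NeZero M]
    (hMN : (N = 2 ∧ M.Prime) ∨ (M = 2 ∧ N.Prime))
    {A : Type*} [Ring A] [HopfAlgebra k A]
    (f : SmashCoproduct k (GammaGroup M N) (Multiplicative (ZMod M)) →ₐc[k] A)
    (hf : Function.Surjective f)
    (hinf : ¬ Module.Finite k A)
    (hcocomm : ¬ Coalgebra.IsCocomm k A) :
    ∃ e : SmashCoproduct k (GammaGroup M N) (Multiplicative (ZMod M)) ≃ₐc[k] A,
      ∀ x, e x = f x :=
  theorem3p4_general M N hMN f hf hinf hcocomm
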